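/- Let $X$ be a random variable whose distribution is parameterized by $\theta\in\Theta$ and has, under the parameter value $\theta$, a probability density (or mass) function $f(\cdot;\theta)$ (all with respect to a common reference measure). Let $X_1,X_2,\dots$ be i.i.d. samples of $X$, write $f_n(x_1,\dots,x_n;\theta)=\prod_{i=1}^n f(x_i;\theta)$ for the joint density (or mass) function of $(X_1,\dots,X_n)$, and let $\Pr\{\,\cdot\mid\theta\}$ denote probability under the parameter value $\theta$. For $\theta',\theta''\in\Theta$ and $b,c>0$, let $b<\Upsilon_n(\theta',\theta'')<c$ denote the event $$b\,f_n(X_1,\dots,X_n;\theta')<f_n(X_1,\dots,X_n;\theta'')<c\,f_n(X_1,\dots,X_n;\theta'),$$ so that $\Upsilon_n(\theta',\theta'')$ is the likelihood ratio $f_n(X_1,\dots,X_n;\theta'')/f_n(X_1,\dots,X_n;\theta')$ whenever the denominator is non-zero. Let $\theta,\theta',\theta''\in\Theta$. Assume that $\Pr\{f(X;\theta')f(X;\theta'')=0\mid\theta\}=0$ and that, under $\theta$, the variance of $\ln\frac{f(X;\theta'')}{f(X;\theta')}$ is positive and finite. Then, for all $\alpha,\beta\in(0,1)$, $$\lim_{n\to\infty}\Pr\Big\{\beta<\Upsilon_n(\theta',\theta'')<\frac1\alpha\;\Big|\;\theta\Big\}=0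 .$$ -/

import Mathlib

open MeasureTheory ProbabilityTheory Filter
open scoped Topology ENNReal

/-- `S 0, S 1, …` are i.i.d. samples of the random variable `X`, whose distribution is
parameterized by `θ : Θ`: under `P θ`, the law of `X` has density `f θ` with respect to the
reference measure `ν`. Lebesgue measure as `ν` gives probability density functions, counting
measure gives probability mass functions. -/
structure IsIIDSampleModel {Θ Ω 𝓧 : Type*} [MeasurableSpace Ω] [MeasurableSpace 𝓧]
    (ν : Measure 𝓧) (f : Θ → 𝓧 → ℝ) (P : Θ → Measure Ω)
    (X : Ω → 𝓧) (S : ℕ → Ω → 𝓧) : Prop where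
  isProbabilityMeasure : ∀ θ, IsProbabilityMeasure (P θ)
  density_nonneg : ∀ θ x, 0 ≤ f θ x
  density_measurable : ∀ θ, Measurable (f θ)
  measurable_X : Measurable X
  measurable_S : ∀ i, Measurable (S i)
  law_X : ∀ θ, (P θ).map X = ν.withDensity (fun x => ENNReal.ofReal (f θ x))
  identDistrib : ∀ θ i, IdentDistrib (S i) X (P θ) (P θ)
  indep : ∀ θ, iIndepFun S (P θ)

/-- The joint density (or mass function) `f_n (x_1, …, x_n; θ)` of `n` i.i.d. samples, each with
density (or mass function) `f (·; θ)`. -/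
noncomputable def jointDensity {Θ 𝓧 : Type*} (f : Θ → 𝓧 → ℝ) (n : ℕ) (x : Fin n → 𝓧) (θ : Θ) : ℝ :=
  ∏ i, f θ (x i)

/-- The relation `b < Υ_n (x; θ', θ'') < c` between the likelihood ratio and the numbers `b`, `c`.
It is expressed without division, so it is meaningful also where `f_n (x; θ') = 0`. -/
def LikelihoodRatioBetween {Θ 𝓧 : Type*} (f : Θ → 𝓧 → ℝ) (n : ℕ) (x : Fin n → 𝓧) (θ' θ'' : Θ)
    (b c : ℝ) : Prop :=
  b * jointDensity f n x θ' < jointDensity f n x θ'' ∧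
    jointDensity f n x θ'' < c * jointDensity f n x θ'

/-! Almost surely no density vanishes, so the logarithm of the likelihood ratio is a random walk
whose i.i.d. steps have positive finite variance, and the event confines it to a fixed bounded
interval. With nonzero mean the walk drifts away linearly; with zero mean it spreads at scale `√n`,
so after rescaling the interval shrinks to a point, which has Gaussian mass zero. -/

/-- Partial sums of square-integrable i.i.d. variables with nonzero mean leave every bounded
interval, by the strong law of large numbers. -/
lemma tendsto_measure_abs_sum_le_of_integral_ne_zero {Ω : Type*} [MeasurableSpace Ω]
    {P : Measure Ω} [IsProbabilityMeasure P] {Y : ℕ → Ω → ℝ}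
    (hint : Integrable (Y 0) P) (hmean : P[Y 0] ≠ 0) (hindep : iIndepFun Y P)
    (hident : ∀ i, IdentDistrib (Y i) (Y 0) P P) (C : ℝ) :
    Tendsto (fun n : ℕ => P {ω | |∑ i ∈ Finset.range n, Y i ω| ≤ C}) atTop (𝓝 0) := by
  have hlaw := strong_law_ae_real Y hint (fun i j hij => hindep.indepFun hij) hident
  have hmeas : ∀ n : ℕ, AEStronglyMeasurable
      (fun ω => (∑ i ∈ Finset.range n, Y i ω) / (n : ℝ)) P := fun n =>
    ((Finset.aemeasurable_fun_sum _ fun i _ => (hident i).aemeasurable_fst).div_const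
      _).aestronglyMeasurable
  have hprob := tendstoInMeasure_iff_norm.1 (tendstoInMeasure_of_tendsto_ae hmeas hlaw)
    (|P[Y 0]| / 2) (by positivity)
  have hlarge : ∀ᶠ n : ℕ in atTop, C / n ≤ |P[Y 0]| / 2 :=
    (tendsto_const_div_atTop_nhds_zero_nat C).eventually_le_const (by positivity)
  refine tendsto_of_tendsto_of_tendsto_of_le_of_le' tendsto_const_nhds hprob
    (Eventually.of_forall fun n => zero_le) ?_
  filter_upwards [hlarge] with n hn
  refine measure_mono fun ω hω => ?_
  have hω' : |(∑ i ∈ Finset.range n, Y i ω) / (n : ℝ)| ≤ C / n := by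
    rw [abs_div, Nat.abs_cast]
    exact div_le_div_of_nonneg_right hω n.cast_nonneg
  -- An average of size at most half of `|P[Y 0]|` misses the mean by at least the other half.
  have htri := abs_sub_abs_le_abs_sub (P[Y 0]) ((∑ i ∈ Finset.range n, Y i ω) / (n : ℝ))
  rw [abs_sub_comm (∫ ω, Y 0 ω ∂P)] at htri
  rw [Set.mem_ofPred_eq, Real.norm_eq_abs]
  linarith

/-- Partial sums of centered i.i.d. variables with finite nonzero variance leave every bounded
interval, by the central limit theorem. -/
lemma tendsto_measure_abs_sum_le_of_integral_eq_zero {Ω : Type*} [MeasurableSpace Ω]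
    {P : Measure Ω} [IsProbabilityMeasure P] {Y : ℕ → Ω → ℝ}
    (hL2 : MemLp (Y 0) 2 P) (hvar : Var[Y 0; P] ≠ 0) (hmean : P[Y 0] = 0)
    (hindep : iIndepFun Y P) (hident : ∀ i, IdentDistrib (Y i) (Y 0) P P) (C : ℝ) :
    Tendsto (fun n : ℕ => P {ω | |∑ i ∈ Finset.range n, Y i ω| ≤ C}) atTop (𝓝 0) := by
  set v := Var[Y 0; P].toNNReal
  have hv : v ≠ 0 := by
    simpa [v] using (variance_nonneg (Y 0) P).lt_of_ne' hvar
  have hclt := tendstoInDistribution_inv_sqrt_mul_sum_sub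
    (HasLaw.id (μ := gaussianReal 0 v)) hL2 hindep hident
  simp only [hmean, mul_zero, sub_zero] at hclt
  have := nullSingletonClass_gaussianReal (μ := 0) hv
  refine ENNReal.tendsto_nhds_zero.2 fun δ hδ => ?_
  -- The limit law has no atom at 0, so a small enough closed ball has mass below `δ`; the
  -- portmanteau theorem carries this bound to the rescaled sums.
  have hball : Tendsto (fun r => gaussianReal 0 v (Metric.cthickening r {0})) (𝓝 0) (𝓝 0) := by
    simpa using tendsto_measure_cthickening_of_isClosed (μ := gaussianReal 0 v)
      ⟨1, one_pos, measure_ne_top _ _⟩ (isClosed_singleton (x := (0 : ℝ)))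
  obtain ⟨r, hr, hr0⟩ := (((hball.mono_left nhdsWithin_le_nhds).eventually_lt_const hδ).and
    (self_mem_nhdsWithin (s := Set.Ioi (0 : ℝ)))).exists
  have hr0 : 0 < r := hr0
  rw [Metric.cthickening_singleton _ hr0.le] at hr
  have hlimsup := ProbabilityMeasure.limsup_measure_closed_le_of_tendsto hclt.tendsto
    (Metric.isClosed_closedBall (x := (0 : ℝ)) (ε := r))
  simp only [ProbabilityMeasure.coe_mk, Measure.map_id] at hlimsup
  have hscale : Tendsto (fun n : ℕ => (√(n : ℝ))⁻¹ * C) atTop (𝓝 0) := by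
    simpa using (tendsto_inv_atTop_zero.comp
      (Real.tendsto_sqrt_atTop.comp tendsto_natCast_atTop_atTop)).mul_const C
  filter_upwards [eventually_lt_of_limsup_lt (hlimsup.trans_lt hr),
    hscale.eventually_le_const hr0] with n hn hCn
  rw [Measure.map_apply_of_aemeasurable (hclt.forall_aemeasurable n)
    Metric.isClosed_closedBall.measurableSet] at hn
  refine (measure_mono fun ω hω => ?_).trans hn.le
  rw [Set.mem_preimage, mem_closedBall_zero_iff, Real.norm_eq_abs, abs_mul,
    abs_of_nonneg (by positivity)]
  exact (mul_le_mul_of_nonneg_left hω (by positivity)).trans hCn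

/-- Partial sums of i.i.d. variables with finite nonzero variance leave every bounded interval. -/
lemma tendsto_measure_abs_sum_le {Ω : Type*} [MeasurableSpace Ω]
    {P : Measure Ω} [IsProbabilityMeasure P] {Y : ℕ → Ω → ℝ}
    (hL2 : MemLp (Y 0) 2 P) (hvar : Var[Y 0; P] ≠ 0)
    (hindep : iIndepFun Y P) (hident : ∀ i, IdentDistrib (Y i) (Y 0) P P) (C : ℝ) :
    Tendsto (fun n : ℕ => P {ω | |∑ i ∈ Finset.range n, Y i ω| ≤ C}) atTop (𝓝 0) := by
  by_cases hmean : P[Y 0] = 0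
  · exact tendsto_measure_abs_sum_le_of_integral_eq_zero hL2 hvar hmean hindep hident C
  · exact tendsto_measure_abs_sum_le_of_integral_ne_zero (hL2.integrable one_le_two) hmean hindep
      hident C

/-- Where no density vanishes, bounds on the likelihood ratio are bounds on the sum of the
logarithms of the individual ratios. -/
lemma LikelihoodRatioBetween.sum_log_mem_Ioo {Θ 𝓧 : Type*} {f : Θ → 𝓧 → ℝ} {n : ℕ}
    {x : Fin n → 𝓧} {θ' θ'' : Θ} {b c : ℝ} (hf : ∀ θ y, 0 ≤ f θ y)
    (hne : ∀ i, f θ' (x i) * f θ'' (x i) ≠ 0) (hb : 0 < b)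
    (h : LikelihoodRatioBetween f n x θ' θ'' b c) :
    ∑ i, Real.log (f θ'' (x i) / f θ' (x i)) ∈ Set.Ioo (Real.log b) (Real.log c) := by
  have hpos' : 0 < jointDensity f n x θ' :=
    Finset.prod_pos fun i _ => (hf _ _).lt_of_ne' (left_ne_zero_of_mul (hne i))
  have hpos'' : 0 < jointDensity f n x θ'' :=
    Finset.prod_pos fun i _ => (hf _ _).lt_of_ne' (right_ne_zero_of_mul (hne i))
  have hsum : ∑ i, Real.log (f θ'' (x i) / f θ' (x i)) =
      Real.log (jointDensity f n x θ'' / jointDensity f n x θ') := by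
    rw [jointDensity, jointDensity, ← Finset.prod_div_distrib, Real.log_prod]
    exact fun i _ => div_ne_zero (right_ne_zero_of_mul (hne i)) (left_ne_zero_of_mul (hne i))
  rw [hsum]
  exact ⟨Real.log_lt_log hb ((lt_div_iff₀ hpos').2 h.1),
    Real.log_lt_log (div_pos hpos'' hpos') ((div_lt_iff₀ hpos').2 h.2)⟩

theorem theorem6 {Θ Ω 𝓧 : Type*} [MeasurableSpace Ω] [MeasurableSpace 𝓧]
    (ν : Measure 𝓧) (f : Θ → 𝓧 → ℝ) (P : Θ → Measure Ω)
    (X : Ω → 𝓧) (S : ℕ → Ω → 𝓧) (hmodel : IsIIDSampleModel ν f P X S)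
    (θ θ' θ'' : Θ)
    (hne : P θ {ω | f θ' (X ω) * f θ'' (X ω) = 0} = 0)
    (hvar_pos : 0 < evariance (fun ω => Real.log (f θ'' (X ω) / f θ' (X ω))) (P θ))
    (hvar_fin : evariance (fun ω => Real.log (f θ'' (X ω) / f θ' (X ω))) (P θ) < ⊤)
    (α β : ℝ) (hα : α ∈ Set.Ioo (0 : ℝ) 1) (hβ : β ∈ Set.Ioo (0 : ℝ) 1) :
    Tendsto
      (fun n : ℕ => P θ {ω | LikelihoodRatioBetween f n (fun i => S i ω) θ' θ'' β (1 / α)})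
      atTop (𝓝 0) := by
  have := hmodel.isProbabilityMeasure θ
  let g : 𝓧 → ℝ := fun y => Real.log (f θ'' y / f θ' y)
  have hf := hmodel.density_measurable
  have hg : Measurable g := Real.measurable_log.comp ((hf θ'').div (hf θ'))
  have hidentX : ∀ i, IdentDistrib (fun ω => g (S i ω)) (fun ω => g (X ω)) (P θ) (P θ) :=
    fun i => (hmodel.identDistrib θ i).comp hg
  have hident : ∀ i, IdentDistrib (fun ω => g (S i ω)) (fun ω => g (S 0 ω)) (P θ) (P θ) :=
    fun i => (hidentX i).trans (hidentX 0).symm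
  have hL2 : MemLp (fun ω => g (S 0 ω)) 2 (P θ) :=
    (hidentX 0).memLp_iff.2 ((evariance_lt_top_iff_memLp
      (hg.comp hmodel.measurable_X).aestronglyMeasurable).1 hvar_fin)
  have hvar : Var[fun ω => g (S 0 ω); P θ] ≠ 0 := by
    rw [(hidentX 0).variance_eq]
    exact (ENNReal.toReal_pos hvar_pos.ne' hvar_fin.ne).ne'
  have hindep : iIndepFun (fun i ω => g (S i ω)) (P θ) :=
    (hmodel.indep θ).comp (fun _ => g) fun _ => hg
  have hae_single (i : ℕ) : ∀ᵐ ω ∂(P θ), f θ' (S i ω) * f θ'' (S i ω) ≠ 0 :=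
    (hmodel.identDistrib θ i).symm.ae_snd (p := fun y => f θ' y * f θ'' y ≠ 0)
      (((hf θ').mul (hf θ'')) (measurableSet_singleton 0).compl)
      (ae_iff.2 (by simpa only [not_not] using hne))
  have hae : ∀ᵐ ω ∂(P θ), ∀ i, f θ' (S i ω) * f θ'' (S i ω) ≠ 0 :=
    ae_all_iff.2 hae_single
  have hsum := tendsto_measure_abs_sum_le (Y := fun i ω => g (S i ω)) hL2 hvar hindep hident
    (max |Real.log β| |Real.log (1 / α)|)
  have hle (n : ℕ) :
      P θ {ω | LikelihoodRatioBetween f n (fun i => S i ω) θ' θ'' β (1 / α)} ≤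
        P θ {ω | |∑ i ∈ Finset.range n, g (S i ω)| ≤
          max |Real.log β| |Real.log (1 / α)|} := by
    -- The inclusion holds only almost everywhere: logarithms need nonvanishing densities.
    apply measure_mono_ae
    filter_upwards [hae] with ω hω hbetween
    have hmem := LikelihoodRatioBetween.sum_log_mem_Ioo hmodel.density_nonneg
      (fun i : Fin n => hω i) hβ.1 hbetween
    rw [Fin.sum_univ_eq_sum_range (fun i => g (S i ω))] at hmem
    exact abs_le_max_abs_abs hmem.1.le hmem.2.le
  exact tendsto_of_tendsto_of_tendsto_of_le_of_le' tendsto_const_nhds hsum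
    (Eventually.of_forall fun _ => zero_le) (Eventually.of_forall hle)
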